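/- All Markov chains below have a finite state space, are irreducible, and are lazy ($\mathsf P(u,u)\ge\frac12$ for every state $u$). For such a chain on $K$ with transition matrix $\mathsf P$ and (unique) stationary distribution $\pi$, write $A^c=K\setminus A$, $\pi(A)=\sum_{v\in A}\pi(v)$, $\mathsf P(v,D)=\sum_{w\in D}\mathsf P(v,w)$ and $\mathsf Q(A,C)=\sum_{u\in A,\,v\in C}\pi(u)\mathsf P(u,v)$. Murali's isoperimetric constant is the number $\beta^+(K)\ge 0$ with $$\beta^+(K)^2=\inf_{A}\frac{\mathsf Q(A,A^c)^2}{\pi(A)\,\pi(A^c)},$$ and, for $x>0$, $$h_2^+(x)=\inf_{A:\ \pi(A)\le x}h_2^+(A),\qquad h_2^+(A)=\frac{\sum_{v\in A}\sqrt{\mathsf P(v,A^c)}\;\pi(v)}{\min\{\pi(A),\pi(A^c)\}},$$ where both infima are over nonempty proper subsets $A$ of $K$ and the infimum of the empty set is $+\infty$. **Theorem.** Let $n\ge 1$, let $K_1,\dots,K_n$ be such Markov chains with transition matrices $\mathsf P_1,\dots,\mathsf P_n$, and let $K^n=K_1\times\cdots\times K_n$ be their Cartesian product, i.e. the Markov chain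 which at each step chooses a coordinate $i\in\{1,\dots,n\}$ uniformly at random and makes one step of $\mathsf P_i$ in that coordinate, leaving the other coordinates unchanged. Then for every $x$ with $0<x\le\frac12$ the quantity $h_2^+(x)$ of the chain $K^n$ satisfies $$h_2^+(x)\ \ge\ \frac12\,\min_{1\le i\le n}\beta^+(K_i)\,\sqrt{\frac{-\log\bigl(x(1-x)\bigr)}{n}}.$$ -/

import Mathlib

open scoped ENNReal

/-- `P` is the transition matrix of a finite, irreducible, lazy Markov chain on the state
space `K`. -/
structure IsLazyIrreducibleChain {K : Type*} [Fintype K] [DecidableEq K]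
    (P : Matrix K K ℝ) : Prop where
  nonneg : ∀ u v, 0 ≤ P u v
  row_sum : ∀ u, ∑ v, P u v = 1
  irreducible : ∀ u v, ∃ t : ℕ, 0 < (P ^ t) u v
  lazy : ∀ u, 1 / 2 ≤ P u u

/-- `π` is a stationary distribution of `P`: a probability vector with `π P = π`.
(For an irreducible chain there is exactly one.) -/
structure IsStationaryDistribution {K : Type*} [Fintype K]
    (P : Matrix K K ℝ) (π : K → ℝ) : Prop where
  nonneg : ∀ v, 0 ≤ π v
  sum_eq_one : ∑ v, π v = 1
  stationary : ∀ v, ∑ u, π u * P u v = π v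

/-- The measure `π(A)` of a set `A` of states. -/
def setMeasure {K : Type*} (π : K → ℝ) (A : Finset K) : ℝ :=
  ∑ v ∈ A, π v

/-- The ergodic flow `Q(A, C) = ∑_{u ∈ A, v ∈ C} π(u) P(u, v)`. -/
def ergodicFlow {K : Type*} (P : Matrix K K ℝ) (π : K → ℝ) (A C : Finset K) : ℝ :=
  ∑ u ∈ A, ∑ v ∈ C, π u * P u v

/-- `Q₂(C, D) = ∑_{v ∈ C} √P(v, D) π(v)`, where `P(v, D) = ∑_{w ∈ D} P(v, w)`. -/
noncomputable def flowTwo {K : Type*} (P : Matrix K K ℝ) (π : K → ℝ) (C D : Finset K) : ℝ :=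
  ∑ v ∈ C, √(∑ w ∈ D, P v w) * π v

/-- The discrete 2-gradient of a set, `h₂⁺(A) = Q₂(A, Aᶜ) / min {π(A), π(Aᶜ)}`. -/
noncomputable def gradTwoSet {K : Type*} [Fintype K] [DecidableEq K]
    (P : Matrix K K ℝ) (π : K → ℝ) (A : Finset K) : ℝ :=
  flowTwo P π A Aᶜ / min (setMeasure π A) (setMeasure π Aᶜ)

/-- `h₂⁺(x) = inf {h₂⁺(A) : π(A) ≤ x}`, over the nonempty proper subsets `A` of the state space;
the infimum is taken in `[0, ∞]`, so that it is `∞` if there is no such `A`. -/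
noncomputable def gradTwo {K : Type*} [Fintype K] [DecidableEq K]
    (P : Matrix K K ℝ) (π : K → ℝ) (x : ℝ) : ℝ≥0∞ :=
  ⨅ (A : Finset K) (_ : A.Nonempty) (_ : Aᶜ.Nonempty) (_ : setMeasure π A ≤ x),
    ENNReal.ofReal (gradTwoSet P π A)

/-- Murali's constant squared, `(β⁺)² = inf_A Q(A, Aᶜ)² / (π(A) π(Aᶜ))`, over the nonempty proper
subsets `A` of the state space; it is `∞` for a one-point state space. -/
noncomputable def muraliSq {K : Type*} [Fintype K] [DecidableEq K]
    (P : Matrix K K ℝ) (π : K → ℝ) : ℝ≥0∞ :=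
  ⨅ (A : Finset K) (_ : A.Nonempty) (_ : Aᶜ.Nonempty),
    ENNReal.ofReal (ergodicFlow P π A Aᶜ ^ 2 / (setMeasure π A * setMeasure π Aᶜ))

/-- Murali's isoperimetric constant `β⁺`. -/
noncomputable def muraliConst {K : Type*} [Fintype K] [DecidableEq K]
    (P : Matrix K K ℝ) (π : K → ℝ) : ℝ≥0∞ :=
  muraliSq P π ^ (1 / 2 : ℝ)

/-- The Cartesian product of `n` chains: choose a coordinate `i` uniformly at random and make a
step of the `i`-th chain in that coordinate, leaving the other coordinates unchanged. -/
noncomputable def productChain {n : ℕ} {K : Fin n → Type*} [∀ i, DecidableEq (K i)]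
    (P : ∀ i, Matrix (K i) (K i) ℝ) : Matrix (∀ i, K i) (∀ i, K i) ℝ :=
  fun x y => (1 / (n : ℝ)) *
    ∑ i, if ∀ j, j ≠ i → y j = x j then P i (x i) (y i) else 0

/-! The argument is a Bobkov-style tensorisation. Write `I` for the profile, `m` for the mean of a
function `f` on one factor with values in `[0, 1]`, and `V` for its variance. It suffices to prove
`β I(μ(A)) ≤ ∑_{v ∈ A} μ(v) √(exitSum v)` on the product: the chain leaves `A` from `v` with
probability `exitSum v / n`, and `I(a) ≥ (a/2) √(-log (x(1-x)))` when `a ≤ x ≤ 1/2`.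

A bound on sets does not pass to products, so one factor is given a functional form,
`IsoperimetricBound.profile_mean_le`, which contains both the gradient of `f` and `I(f)`. Applied to
the measures `f(u)` of the slices of `A`, it lets the induction hypothesis replace `β I(f(u))`
(`profile_le_sum_sqrt_exitSum`).

The functional form rests on two facts. Murali's constant bounds `β √V` by the L¹ energy of `f`,
through level sets and Cauchy–Schwarz (`IsoperimetricBound.sqrt_variance_le`). The concavity defect
of `I` is controlled by the variance, `I(m)² ≤ (mean of I(f))² + 2V` (`profile_mean_sq_le`). The
resulting factor `√2` is absorbed by laziness. -/

/-! ### The profile and its concavity defect -/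

/-- The isoperimetric profile `a(1-a) √(-log (a(1-a)))`. -/
noncomputable def profile (a : ℝ) : ℝ :=
  a * (1 - a) * √(-Real.log (a * (1 - a)))

theorem profile_nonneg {a : ℝ} (h0 : 0 ≤ a) (h1 : a ≤ 1) : 0 ≤ profile a :=
  mul_nonneg (mul_nonneg h0 (by linarith)) (Real.sqrt_nonneg _)

@[simp] theorem profile_zero : profile 0 = 0 := by simp [profile]

@[simp] theorem profile_one : profile 1 = 0 := by simp [profile]

theorem mul_neg_log_sub_half_le {y : ℝ} (hy : 0 < y) :
    y * (-Real.log y - 1 / 2) ≤ 1 / 4 := by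
  have h := Real.log_le_sub_one_of_pos (show 0 < 1 / (4 * y) by positivity)
  have h4 : Real.log 4 ≤ 3 / 2 := by
    have : Real.log 4 = 2 * Real.log 2 := by
      rw [show (4 : ℝ) = 2 ^ 2 by norm_num, Real.log_pow]; norm_num
    linarith [Real.log_two_lt_d9]
  rw [one_div, Real.log_inv, Real.log_mul (by norm_num) hy.ne'] at h
  have h' : -Real.log y - 1 / 2 ≤ (4 * y)⁻¹ := by linarith
  calc y * (-Real.log y - 1 / 2) ≤ y * (4 * y)⁻¹ := by gcongr
    _ = 1 / 4 := by field_simp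

/-- The constant `11/8` is a rational lower bound for `log 4`. -/
theorem one_le_neg_log_of_le_quarter {y : ℝ} (hy : 0 < y) (hy' : y ≤ 1 / 4) :
    11 / 8 ≤ -Real.log y := by
  have h : Real.log y ≤ Real.log (1 / 4) := Real.log_le_log hy hy'
  have h4 : Real.log (1 / 4) = -(2 * Real.log 2) := by
    rw [one_div, Real.log_inv, show (4 : ℝ) = 2 ^ 2 by norm_num, Real.log_pow]; norm_num
  linarith [Real.log_two_gt_d9]

/-- The harmonic mean is at most the geometric mean, in second-order form. -/
theorem sqrt_mul_sub_ge {a b : ℝ} (ha : 11 / 8 ≤ a) (hb : 11 / 8 ≤ b) :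
    (b - a) / 2 - (b - a) ^ 2 / 4 ≤ √a * √b - a := by
  have hp : 0 < a + b := by linarith
  have h1 : a + (b - a) / 2 - (b - a) ^ 2 / 4 ≤ 2 * (a * b) / (a + b) := by
    rw [le_div_iff₀ hp]
    nlinarith [mul_nonneg (sq_nonneg (b - a)) (show 0 ≤ a + b - 2 by linarith)]
  have h2 : 2 * (a * b) / (a + b) ≤ √a * √b := by
    rw [div_le_iff₀ hp]
    have ea := Real.sq_sqrt (show 0 ≤ a by linarith)
    have eb := Real.sq_sqrt (show 0 ≤ b by linarith)
    have hs : 0 ≤ √a * √b := by positivity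
    nlinarith [mul_nonneg hs (sq_nonneg (√a - √b))]
  linarith

/-- Tangent-line bound for the profile in the variable `y = a(1-a)`: the left side is `y² L + y (L -
1/2)(w - y)` minus a quadratic error, with `L = -log y`. -/
theorem profile_mul_aux {y w : ℝ} (hy : 0 < y) (hy' : y ≤ 1 / 4) (hw : 0 < w) (hw' : w ≤ 1 / 4) :
    y * w * -Real.log y + y * (y - w) / 2 - 3 / 4 * (y - w) ^ 2 ≤
      y * √(-Real.log y) * (w * √(-Real.log w)) := by
  have h := sqrt_mul_sub_ge (one_le_neg_log_of_le_quarter hy hy')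
    (one_le_neg_log_of_le_quarter hw hw')
  set s := Real.log y - Real.log w with hs
  have hs1 : -Real.log w - -Real.log y = s := by rw [hs]; ring
  rw [hs1] at h
  have e1 : Real.exp s = y / w := by rw [hs, Real.exp_sub, Real.exp_log hy, Real.exp_log hw]
  have e2 : Real.exp (-s) = w / y := by
    rw [hs, neg_sub, Real.exp_sub, Real.exp_log hy, Real.exp_log hw]
  have h1 : 1 - s ≤ w / y := by rw [← e2]; linarith [Real.add_one_le_exp (-s)]
  have h2 : 2 + s ^ 2 ≤ y / w + w / y := by
    rw [← e1, ← e2]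
    have h3 : (s / 2) ^ 2 ≤ Real.sinh (s / 2) ^ 2 := by
      rw [← sq_abs, ← sq_abs (Real.sinh _), Real.abs_sinh]
      exact pow_le_pow_left₀ (abs_nonneg _) (Real.self_le_sinh_iff.2 (abs_nonneg _)) 2
    have h4 := Real.cosh_two_mul (s / 2)
    rw [Real.cosh_sq, mul_div_cancel₀ s two_ne_zero, Real.cosh_eq] at h4
    linarith
  -- The `3/4` is `1/4` from `s²/4`, plus `1/2` from replacing `1 - w/y` by `y/w - 1`, whose
  -- difference is `y/w + w/y - 2`.
  have key : -Real.log y + (y / w - 1) / 2 - 3 / 4 * (y / w + w / y - 2) ≤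
      √(-Real.log y) * √(-Real.log w) := by
    linarith
  calc _ = y * w * (-Real.log y + (y / w - 1) / 2 - 3 / 4 * (y / w + w / y - 2)) := by
        field_simp; ring
    _ ≤ y * w * (√(-Real.log y) * √(-Real.log w)) := by gcongr
    _ = _ := by ring

/-- The linear coefficient is `I(m) I'(m)`, so this bounds `I(m) I(z)` below by its tangent at `m`,
with quadratic error. -/
theorem profile_mul_ge {m z : ℝ} (hm0 : 0 < m) (hm1 : m < 1) (hz0 : 0 ≤ z) (hz1 : z ≤ 1) :
    profile m ^ 2 + m * (1 - m) * (1 - 2 * m) * (-Real.log (m * (1 - m)) - 1 / 2) * (z - m)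
      - (z - m) ^ 2 ≤ profile m * profile z := by
  unfold profile
  have hy : 0 < m * (1 - m) := mul_pos hm0 (by linarith)
  have hy' : m * (1 - m) ≤ 1 / 4 := by nlinarith [sq_nonneg (m - 1 / 2)]
  have hw : 0 ≤ z * (1 - z) := mul_nonneg hz0 (by linarith)
  have hw' : z * (1 - z) ≤ 1 / 4 := by nlinarith [sq_nonneg (z - 1 / 2)]
  have hd : z * (1 - z) = m * (1 - m) + (z - m) * (1 - 2 * m) - (z - m) ^ 2 := by ring
  have hd2 : (m * (1 - m) - z * (1 - z)) ^ 2 ≤ (z - m) ^ 2 := by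
    have : (m * (1 - m) - z * (1 - z)) ^ 2 = (z - m) ^ 2 * (z + m - 1) ^ 2 := by ring
    rw [this]
    have h1 : (z + m - 1) ^ 2 ≤ 1 := by nlinarith
    nlinarith [sq_nonneg (z - m)]
  have hc := mul_neg_log_sub_half_le hy
  have hl := one_le_neg_log_of_le_quarter hy hy'
  generalize hyy : m * (1 - m) = y at *
  generalize hww : z * (1 - z) = w at *
  have hsq : (y * √(-Real.log y)) ^ 2 = y ^ 2 * -Real.log y := by
    rw [mul_pow, Real.sq_sqrt (by linarith)]
  rw [hsq]
  -- The error budget `1` splits as `3/4` for `(y - w)²` and `1/4` for the curvature of `z(1-z)`.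
  have hcd : 3 / 4 * (y - w) ^ 2 ≤ (1 - y * (-Real.log y - 1 / 2)) * (z - m) ^ 2 :=
    mul_le_mul (by linarith) hd2 (sq_nonneg _) (by linarith)
  have hlin : y * (1 - 2 * m) * (-Real.log y - 1 / 2) * (z - m) =
      y * (-Real.log y - 1 / 2) * (w - y + (z - m) ^ 2) := by rw [hd]; ring
  rw [hlin]
  -- At `z = 0` or `z = 1` the profile vanishes and `-log w` carries no information; the leftover
  -- `y²/2` is below `3/4 y²`.
  rcases hw.eq_or_lt with h0 | h0
  · rw [← h0] at hcd ⊢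
    nlinarith [sq_nonneg y]
  · have := profile_mul_aux hy hy' h0 hw'
    nlinarith

/-- Averaging the tangent bound kills the linear term and gives `I(m)² - V ≤ I(m) J`, where `J` is
the mean of `I(f)`; then `2 I(m) J ≤ I(m)² + J²`. -/
theorem profile_mean_sq_le {ι : Type*} [Fintype ι] (p f : ι → ℝ) (hp : ∀ i, 0 ≤ p i)
    (hp1 : ∑ i, p i = 1) (hf0 : ∀ i, 0 ≤ f i) (hf1 : ∀ i, f i ≤ 1) :
    profile (∑ i, p i * f i) ^ 2 ≤ (∑ i, p i * profile (f i)) ^ 2 +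
      2 * ∑ i, p i * (f i - ∑ j, p j * f j) ^ 2 := by
  set m := ∑ i, p i * f i with hm
  have hm0 : 0 ≤ m := Finset.sum_nonneg fun i _ => mul_nonneg (hp i) (hf0 i)
  have hm1 : m ≤ 1 := by
    rw [← hp1]; exact Finset.sum_le_sum fun i _ => mul_le_of_le_one_right (hp i) (hf1 i)
  have hV : 0 ≤ ∑ i, p i * (f i - m) ^ 2 :=
    Finset.sum_nonneg fun i _ => mul_nonneg (hp i) (sq_nonneg _)
  rcases hm0.eq_or_lt with h | h0
  · rw [← h] at hV ⊢; rw [profile_zero]; nlinarith [sq_nonneg (∑ i, p i * profile (f i))]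
  rcases hm1.eq_or_lt with h | h1
  · rw [h] at hV ⊢; rw [profile_one]; nlinarith [sq_nonneg (∑ i, p i * profile (f i))]
  set G := m * (1 - m) * (1 - 2 * m) * (-Real.log (m * (1 - m)) - 1 / 2)
  have hmean : ∑ i, p i * (f i - m) = 0 := by
    simp only [mul_sub, Finset.sum_sub_distrib, ← Finset.sum_mul, hp1, ← hm]; ring
  have key : ∑ i, p i * (profile m ^ 2 + G * (f i - m) - (f i - m) ^ 2) ≤
      ∑ i, p i * (profile m * profile (f i)) :=
    Finset.sum_le_sum fun i _ =>
      mul_le_mul_of_nonneg_left (profile_mul_ge h0 h1 (hf0 i) (hf1 i)) (hp i)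
  have eL : ∑ i, p i * (profile m ^ 2 + G * (f i - m) - (f i - m) ^ 2) =
      profile m ^ 2 - ∑ i, p i * (f i - m) ^ 2 := by
    have : ∀ i, p i * (profile m ^ 2 + G * (f i - m) - (f i - m) ^ 2) =
        p i * profile m ^ 2 + G * (p i * (f i - m)) - p i * (f i - m) ^ 2 := fun i => by ring
    simp only [this, Finset.sum_sub_distrib, Finset.sum_add_distrib, ← Finset.sum_mul,
      ← Finset.mul_sum, hp1, hmean]
    ring
  have eR : ∑ i, p i * (profile m * profile (f i)) = profile m * ∑ i, p i * profile (f i) := by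
    rw [Finset.mul_sum]; exact Finset.sum_congr rfl fun i _ => by ring
  rw [eL, eR] at key
  nlinarith [sq_nonneg (profile m - ∑ i, p i * profile (f i))]

/-! ### The functional inequality on one factor -/

/-- The triangle inequality for the plane vectors `p i • (x i, y i)`. -/
theorem sqrt_sq_sum_add_le {ι : Type*} [Fintype ι] (p x y : ι → ℝ) (hp : ∀ i, 0 ≤ p i) :
    √((∑ i, p i * x i) ^ 2 + (∑ i, p i * y i) ^ 2) ≤ ∑ i, p i * √(x i ^ 2 + y i ^ 2) := by
  have h := norm_sum_le Finset.univ fun i => (p i : ℂ) * ⟨x i, y i⟩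
  have e : ∑ i, (p i : ℂ) * ⟨x i, y i⟩ = (⟨∑ i, p i * x i, ∑ i, p i * y i⟩ : ℂ) := by
    apply Complex.ext <;> simp
  simp only [e, norm_mul, Complex.norm_eq_sqrt_sq_add_sq, Complex.ofReal_re,
    Complex.ofReal_im] at h
  simpa [Real.sqrt_sq_eq_abs, abs_of_nonneg (hp _)] using h

theorem antitone_ite_lt (c : ℝ) : Antitone fun t : ℝ => if t < c then (1 : ℝ) else 0 := by
  intro s t hst
  dsimp only
  split_ifs with h1 h2 <;> first | exact absurd (hst.trans_lt h1) h2 | norm_num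

theorem integral_ite_lt {c : ℝ} (h0 : 0 ≤ c) (h1 : c ≤ 1) :
    ∫ t in (0 : ℝ)..1, (if t < c then (1 : ℝ) else 0) = c := by
  have e : (fun t : ℝ => if t < c then (1 : ℝ) else 0) = (Set.Iio c).indicator 1 := by
    ext t; simp [Set.indicator]
  have e2 : Set.Iio c ∩ Set.Ioc 0 1 = Set.Ioo 0 c := by
    ext t
    simp only [Set.mem_inter_iff, Set.mem_Iio, Set.mem_Ioc, Set.mem_Ioo]
    exact ⟨fun h => ⟨h.2.1, h.1⟩, fun h => ⟨h.2, h.1, by linarith⟩⟩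
  rw [e, intervalIntegral.integral_of_le zero_le_one,
    MeasureTheory.integral_indicator_one measurableSet_Iio, MeasureTheory.measureReal_restrict_apply
      measurableSet_Iio, e2, Real.volume_real_Ioo_of_le h0, sub_zero]

theorem ite_lt_mul_one_sub (c d t : ℝ) :
    (if t < c then (1 : ℝ) else 0) * (1 - if t < d then (1 : ℝ) else 0) =
      (if t < c then (1 : ℝ) else 0) - if t < min c d then (1 : ℝ) else 0 := by
  simp only [lt_min_iff]
  split_ifs <;> simp_all

theorem intervalIntegrable_fun_sum {ι : Type*} [Fintype ι] {g : ι → ℝ → ℝ} {a b : ℝ}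
    (h : ∀ i, IntervalIntegrable (g i) MeasureTheory.volume a b) :
    IntervalIntegrable (fun t => ∑ i, g i t) MeasureTheory.volume a b := by
  simpa only [Finset.sum_fn] using IntervalIntegrable.sum Finset.univ fun i _ => h i

theorem intervalIntegrable_ite_lt (c : ℝ) :
    IntervalIntegrable (fun t : ℝ => if t < c then (1 : ℝ) else 0) MeasureTheory.volume 0 1 :=
  (antitone_ite_lt c).intervalIntegrable

theorem intervalIntegrable_ite_lt_mul (c d : ℝ) :
    IntervalIntegrable (fun t : ℝ => (if t < c then (1 : ℝ) else 0) *
      (1 - if t < d then (1 : ℝ) else 0)) MeasureTheory.volume 0 1 := by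
  simp only [ite_lt_mul_one_sub]
  exact (intervalIntegrable_ite_lt _).sub (intervalIntegrable_ite_lt _)

theorem integral_ite_lt_mul {c d : ℝ} (hc : 0 ≤ c) (hc1 : c ≤ 1) (hd : 0 ≤ d) :
    ∫ t in (0 : ℝ)..1, (if t < c then (1 : ℝ) else 0) * (1 - if t < d then (1 : ℝ) else 0) =
      max (c - d) 0 := by
  simp only [ite_lt_mul_one_sub]
  rw [intervalIntegral.integral_sub (intervalIntegrable_ite_lt _) (intervalIntegrable_ite_lt _),
    integral_ite_lt hc hc1, integral_ite_lt (le_min hc hd) (min_le_of_left_le hc1)]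
  rcases le_total c d with h | h
  · rw [min_eq_left h, max_eq_right] <;> linarith
  · rw [min_eq_right h, max_eq_left]; linarith

/-- `β² π(A) π(Aᶜ) ≤ Q(A, Aᶜ)²` for every set `A`, given by its indicator function. -/
def IsoperimetricBound {ι : Type*} [Fintype ι] (P : Matrix ι ι ℝ) (p : ι → ℝ) (β : ℝ) : Prop :=
  ∀ a : ι → ℝ, (∀ v, a v = 0 ∨ a v = 1) →
    β * √((∑ v, p v * a v) * (1 - ∑ v, p v * a v)) ≤
      ∑ u, ∑ v, p u * P u v * (a u * (1 - a v))

/-- Cauchy–Schwarz: centring `a` is free because `f` is already centred, and an indicator of mean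
`α` has variance `α(1-α)`. -/
theorem sum_centered_mul_indicator_le {ι : Type*} [Fintype ι] (p f a : ι → ℝ)
    (hp : ∀ i, 0 ≤ p i) (hp1 : ∑ i, p i = 1) (ha : ∀ v, a v = 0 ∨ a v = 1) :
    ∑ v, p v * (f v - ∑ j, p j * f j) * a v ≤
      √(∑ v, p v * (f v - ∑ j, p j * f j) ^ 2) *
        √((∑ v, p v * a v) * (1 - ∑ v, p v * a v)) := by
  set m := ∑ j, p j * f j with hm
  set α := ∑ v, p v * a v with hα
  have hmean : ∑ i, p i * (f i - m) = 0 := by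
    simp only [mul_sub, Finset.sum_sub_distrib, ← Finset.sum_mul, hp1, ← hm]; ring
  have h1 : ∑ v, p v * (f v - m) * a v = ∑ v, √(p v) * (f v - m) * (√(p v) * (a v - α)) := by
    have : ∀ v, √(p v) * (f v - m) * (√(p v) * (a v - α)) =
        p v * (f v - m) * a v - α * (p v * (f v - m)) := fun v => by
      have := Real.mul_self_sqrt (hp v)
      linear_combination ((f v - m) * (a v - α)) * this
    simp only [this, Finset.sum_sub_distrib, ← Finset.mul_sum, hmean]
    ring
  have h2 : ∑ v, (√(p v) * (f v - m)) ^ 2 = ∑ v, p v * (f v - m) ^ 2 :=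
    Finset.sum_congr rfl fun v _ => by rw [mul_pow, Real.sq_sqrt (hp v)]
  have h3 : ∑ v, (√(p v) * (a v - α)) ^ 2 = α * (1 - α) := by
    have : ∀ v, (√(p v) * (a v - α)) ^ 2 = p v * a v - 2 * α * (p v * a v) + p v * α ^ 2 := by
      intro v
      rw [mul_pow, Real.sq_sqrt (hp v)]
      rcases ha v with h | h <;> rw [h] <;> ring
    simp only [this, Finset.sum_sub_distrib, Finset.sum_add_distrib, ← Finset.sum_mul,
      ← Finset.mul_sum, hp1, ← hα]
    ring
  rw [h1, ← h2, ← h3]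
  exact Real.sum_mul_le_sqrt_mul_sqrt _ _ _

/-- Layer cake writes the variance `V` as an integral over the level sets `{f > t}`. Cauchy–Schwarz
and the isoperimetric bound control each level by `√V` times its flow, and by co-area the flows
integrate to the energy. Dividing by `√V` gives the claim. -/
theorem IsoperimetricBound.sqrt_variance_le {ι : Type*} [Fintype ι] {P : Matrix ι ι ℝ}
    {p : ι → ℝ} {β : ℝ} (h : IsoperimetricBound P p β) (hβ : 0 ≤ β) (hp : ∀ i, 0 ≤ p i)
    (hp1 : ∑ i, p i = 1) (f : ι → ℝ) (hf0 : ∀ i, 0 ≤ f i) (hf1 : ∀ i, f i ≤ 1)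
    (hP : ∀ u v, 0 ≤ P u v) :
    β * √(∑ i, p i * (f i - ∑ j, p j * f j) ^ 2) ≤
      ∑ u, ∑ v, p u * P u v * max (f u - f v) 0 := by
  set m := ∑ j, p j * f j with hm
  set V := ∑ i, p i * (f i - m) ^ 2 with hV
  have hE : 0 ≤ ∑ u, ∑ v, p u * P u v * max (f u - f v) 0 :=
    Finset.sum_nonneg fun u _ => Finset.sum_nonneg fun v _ =>
      mul_nonneg (mul_nonneg (hp u) (hP u v)) (le_max_right _ _)
  have hV0 : 0 ≤ V := Finset.sum_nonneg fun i _ => mul_nonneg (hp i) (sq_nonneg _)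
  rcases hV0.eq_or_lt with h0 | h0
  · simpa [← h0] using hE
  have hmean : ∑ i, p i * (f i - m) = 0 := by
    simp only [mul_sub, Finset.sum_sub_distrib, ← Finset.sum_mul, hp1, ← hm]; ring
  have e1 : ∫ t in (0 : ℝ)..1, ∑ v, p v * (f v - m) * (if t < f v then (1 : ℝ) else 0) = V := by
    rw [intervalIntegral.integral_finsetSum fun v _ => (intervalIntegrable_ite_lt _).const_mul _]
    simp only [intervalIntegral.integral_const_mul, integral_ite_lt (hf0 _) (hf1 _)]
    have : ∀ v, p v * (f v - m) * f v = p v * (f v - m) ^ 2 + m * (p v * (f v - m)) :=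
      fun v => by ring
    simp only [this, Finset.sum_add_distrib, ← Finset.mul_sum, hmean]
    simp [hV]
  have hint : ∀ u v, IntervalIntegrable (fun t : ℝ => p u * P u v *
      ((if t < f u then (1 : ℝ) else 0) * (1 - if t < f v then (1 : ℝ) else 0)))
      MeasureTheory.volume 0 1 := fun u v => (intervalIntegrable_ite_lt_mul _ _).const_mul _
  have hint' : ∀ u, IntervalIntegrable (fun t : ℝ => ∑ v, p u * P u v *
      ((if t < f u then (1 : ℝ) else 0) * (1 - if t < f v then (1 : ℝ) else 0)))
      MeasureTheory.volume 0 1 := fun u =>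
    intervalIntegrable_fun_sum fun v => hint u v
  have e2 : ∫ t in (0 : ℝ)..1, ∑ u, ∑ v, p u * P u v *
      ((if t < f u then (1 : ℝ) else 0) * (1 - if t < f v then (1 : ℝ) else 0)) =
      ∑ u, ∑ v, p u * P u v * max (f u - f v) 0 := by
    rw [intervalIntegral.integral_finsetSum fun u _ => hint' u]
    refine Finset.sum_congr rfl fun u _ => ?_
    rw [intervalIntegral.integral_finsetSum fun v _ => hint u v]
    refine Finset.sum_congr rfl fun v _ => ?_
    rw [intervalIntegral.integral_const_mul, integral_ite_lt_mul (hf0 _) (hf1 _) (hf0 _)]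
  have hi1 : IntervalIntegrable (fun t : ℝ => ∑ v, p v * (f v - m) *
      (if t < f v then (1 : ℝ) else 0)) MeasureTheory.volume 0 1 :=
    intervalIntegrable_fun_sum fun v => (intervalIntegrable_ite_lt (f v)).const_mul (p v * (f v - m))
  have hi2 : IntervalIntegrable (fun t : ℝ => ∑ u, ∑ v, p u * P u v *
      ((if t < f u then (1 : ℝ) else 0) * (1 - if t < f v then (1 : ℝ) else 0)))
      MeasureTheory.volume 0 1 :=
    intervalIntegrable_fun_sum hint'
  have key : β * V ≤ √V * ∑ u, ∑ v, p u * P u v * max (f u - f v) 0 := by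
    rw [← e2, ← e1, ← intervalIntegral.integral_const_mul, ← intervalIntegral.integral_const_mul,
      e1]
    refine intervalIntegral.integral_mono_on zero_le_one (hi1.const_mul _) (hi2.const_mul _)
      fun t _ => ?_
    have ha : ∀ v, (if t < f v then (1 : ℝ) else 0) = 0 ∨ (if t < f v then (1 : ℝ) else 0) = 1 :=
      fun v => by split_ifs <;> simp
    calc _ ≤ β * (√V * √_) := mul_le_mul_of_nonneg_left
          (sum_centered_mul_indicator_le p f _ hp hp1 ha) hβ
      _ = √V * (β * √_) := by ring
      _ ≤ _ := mul_le_mul_of_nonneg_left (h _ ha) (Real.sqrt_nonneg _)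
  have hs : 0 < √V := Real.sqrt_pos.2 h0
  refine le_of_mul_le_mul_left ?_ hs
  calc √V * (β * √V) = β * (√V * √V) := by ring
    _ = β * V := by rw [Real.mul_self_sqrt hV0]
    _ ≤ _ := key

/-- The one-dimensional functional form of the isoperimetric inequality. -/
theorem IsoperimetricBound.profile_mean_le {ι : Type*} [Fintype ι] {P : Matrix ι ι ℝ}
    {p : ι → ℝ} {β : ℝ} (h : IsoperimetricBound P p β) (hβ : 0 ≤ β) (hp : ∀ i, 0 ≤ p i)
    (hp1 : ∑ i, p i = 1) (f : ι → ℝ) (hf0 : ∀ i, 0 ≤ f i) (hf1 : ∀ i, f i ≤ 1)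
    (hP : ∀ u v, 0 ≤ P u v) :
    β * profile (∑ i, p i * f i) ≤
      ∑ u, p u * √((√2 * ∑ v, P u v * max (f u - f v) 0) ^ 2 + (β * profile (f u)) ^ 2) := by
  refine le_trans ?_ (sqrt_sq_sum_add_le p _ _ hp)
  apply Real.le_sqrt_of_sq_le
  have h1 := h.sqrt_variance_le hβ hp hp1 f hf0 hf1 hP
  have h2 := profile_mean_sq_le p f hp hp1 hf0 hf1
  set V := ∑ i, p i * (f i - ∑ j, p j * f j) ^ 2
  have hV0 : 0 ≤ V := Finset.sum_nonneg fun i _ => mul_nonneg (hp i) (sq_nonneg _)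
  have e1 : ∑ u, p u * (√2 * ∑ v, P u v * max (f u - f v) 0) =
      √2 * ∑ u, ∑ v, p u * P u v * max (f u - f v) 0 := by
    simp only [Finset.mul_sum]
    exact Finset.sum_congr rfl fun u _ => Finset.sum_congr rfl fun v _ => by ring
  have e2 : ∑ u, p u * (β * profile (f u)) = β * ∑ u, p u * profile (f u) := by
    rw [Finset.mul_sum]; exact Finset.sum_congr rfl fun u _ => by ring
  have h3 := pow_le_pow_left₀ (mul_nonneg hβ (Real.sqrt_nonneg V)) h1 2
  rw [mul_pow, Real.sq_sqrt hV0] at h3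
  rw [e1, e2, mul_pow, mul_pow, mul_pow, Real.sq_sqrt (by norm_num)]
  -- The defect `2 β² V` is at most twice the squared energy, which is exactly what the factor `√2`
  -- supplies.
  nlinarith [mul_le_mul_of_nonneg_left h2 (sq_nonneg β)]

/-! ### Tensorisation -/

/-- The sum over the coordinates `i` of the probability that a step of the `i`-th chain, in the
coordinate `i` of `v`, leaves the set with indicator function `a`. -/
noncomputable def exitSum {n : ℕ} {K : Fin n → Type*} [∀ i, Fintype (K i)]
    (P : ∀ i, Matrix (K i) (K i) ℝ) (a : (∀ i, K i) → ℝ) (v : ∀ i, K i) : ℝ :=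
  ∑ i, ∑ u, P i (v i) u * (1 - a (Function.update v i u))

theorem exitSum_cons {n : ℕ} {K : Fin (n + 1) → Type*} [∀ i, Fintype (K i)]
    (P : ∀ i, Matrix (K i) (K i) ℝ) (a : (∀ i, K i) → ℝ) (u : K 0) (w : ∀ i : Fin n, K i.succ) :
    exitSum P a (Fin.cons u w) = ∑ z, P 0 u z * (1 - a (Fin.cons z w)) +
      exitSum (fun i => P i.succ) (fun w' => a (Fin.cons u w')) w := by
  simp only [exitSum, Fin.sum_univ_succ, Fin.cons_zero, Fin.cons_succ, Fin.update_cons_zero,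
    Fin.cons_update]

theorem exitSum_nonneg {n : ℕ} {K : Fin n → Type*} [∀ i, Fintype (K i)]
    {P : ∀ i, Matrix (K i) (K i) ℝ} (hP : ∀ i u v, 0 ≤ P i u v) {a : (∀ i, K i) → ℝ}
    (ha : ∀ v, a v = 0 ∨ a v = 1) (v : ∀ i, K i) : 0 ≤ exitSum P a v :=
  Finset.sum_nonneg fun i _ => Finset.sum_nonneg fun u _ => mul_nonneg (hP _ _ _) <| by
    rcases ha (Function.update v i u) with h | h <;> rw [h] <;> norm_num

theorem sum_pi_prod_eq_one {n : ℕ} {K : Fin n → Type*} [∀ i, Fintype (K i)]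
    {p : ∀ i, K i → ℝ} (hp1 : ∀ i, ∑ u, p i u = 1) : ∑ v : ∀ i, K i, ∏ i, p i (v i) = 1 := by
  rw [← Fintype.prod_sum]; simp [hp1]

theorem sum_fin_cons {n : ℕ} {K : Fin (n + 1) → Type*} [∀ i, Fintype (K i)]
    (F : (∀ i, K i) → ℝ) : ∑ v, F v = ∑ u, ∑ w : ∀ i : Fin n, K i.succ, F (Fin.cons u w) := by
  rw [← (Fin.consEquiv K).sum_comp, Fintype.sum_prod_type]; rfl

/-- Trades the factor `√2` for a square root of the exit probability, which laziness keeps below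
`1/2`. -/
theorem sqrt_two_mul_le_sqrt {d : ℝ} (h0 : 0 ≤ d) (h1 : d ≤ 1 / 2) : √2 * d ≤ √d := by
  calc √2 * d = √2 * √d * √d := by rw [mul_assoc, Real.mul_self_sqrt h0]
    _ = √(2 * d) * √d := by rw [Real.sqrt_mul (by norm_num)]
    _ ≤ 1 * √d := by gcongr; exact Real.sqrt_le_one.2 (by linarith)
    _ = √d := one_mul _

theorem IsLazyIrreducibleChain.sum_mul_one_sub_le_half {ι : Type*} [Fintype ι] [DecidableEq ι]
    {P : Matrix ι ι ℝ} (hP : IsLazyIrreducibleChain P) {a : ι → ℝ}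
    (ha : ∀ v, a v = 0 ∨ a v = 1) {u : ι} (hu : a u = 1) :
    ∑ z, P u z * (1 - a z) ≤ 1 / 2 := by
  have h1 : ∀ z, P u z * (1 - a z) ≤ P u z - if z = u then P u z else 0 := by
    intro z
    have := hP.nonneg u z
    split_ifs with h
    · rw [h, hu]; simp
    · rcases ha z with h | h <;> rw [h] <;> linarith
  have h2 := Finset.sum_le_sum fun z (_ : z ∈ Finset.univ) => h1 z
  rw [Finset.sum_sub_distrib, hP.row_sum] at h2
  simp only [Finset.sum_ite_eq', Finset.mem_univ, if_true] at h2
  linarith [hP.lazy u]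

/-- Induction on `n`, splitting off coordinate `0`: square roots of exit probabilities combine as
`√(√D² + √E²) = √(D + E)`, so exit probabilities add over coordinates. -/
theorem profile_le_sum_sqrt_exitSum {n : ℕ} {K : Fin n → Type*}
    [∀ i, Fintype (K i)] [∀ i, DecidableEq (K i)]
    (P : ∀ i, Matrix (K i) (K i) ℝ) (hP : ∀ i, IsLazyIrreducibleChain (P i))
    (p : ∀ i, K i → ℝ) (hp : ∀ i u, 0 ≤ p i u) (hp1 : ∀ i, ∑ u, p i u = 1) {β : ℝ} (hβ : 0 ≤ β)
    (hiso : ∀ i, IsoperimetricBound (P i) (p i) β) (a : (∀ i, K i) → ℝ)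
    (ha : ∀ v, a v = 0 ∨ a v = 1) :
    β * profile (∑ v, (∏ i, p i (v i)) * a v) ≤
      ∑ v, (∏ i, p i (v i)) * (a v * √(exitSum P a v)) := by
  induction n with
  | zero =>
    -- The empty product has one point, so the set has measure `0` or `1`, where the profile
    -- vanishes.
    have e : profile (∑ v : ∀ i, K i, (∏ i, p i (v i)) * a v) = 0 := by
      rw [Fintype.sum_unique]
      rcases ha default with h | h <;> simp [h]
    rw [e, mul_zero]
    exact Finset.sum_nonneg fun v _ => mul_nonneg (Finset.prod_nonneg fun i _ => hp _ _) <| by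
      rcases ha v with h | h <;> rw [h] <;> simp
  | succ n ih =>
    have ha0 : ∀ v, 0 ≤ a v := fun v => by rcases ha v with h | h <;> rw [h] <;> norm_num
    set q : (∀ i : Fin n, K i.succ) → ℝ := fun w => ∏ i, p i.succ (w i) with hq
    have hq0 : ∀ w, 0 ≤ q w := fun w => Finset.prod_nonneg fun i _ => hp _ _
    have hq1 : ∑ w, q w = 1 := sum_pi_prod_eq_one fun i => hp1 i.succ
    set f : K 0 → ℝ := fun u => ∑ w, q w * a (Fin.cons u w) with hf
    have hf0 : ∀ u, 0 ≤ f u := fun u => Finset.sum_nonneg fun w _ => mul_nonneg (hq0 w) (ha0 _)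
    have hf1 : ∀ u, f u ≤ 1 := fun u => by
      rw [← hq1]
      refine Finset.sum_le_sum fun w _ => mul_le_of_le_one_right (hq0 w) ?_
      rcases ha (Fin.cons u w) with h | h <;> simp [h]
    have eL : ∑ v, (∏ i, p i (v i)) * a v = ∑ u, p 0 u * f u := by
      simp only [sum_fin_cons, Fin.prod_univ_succ, Fin.cons_zero, Fin.cons_succ, hf, hq,
        Finset.mul_sum, mul_assoc]
    have eR : ∑ v, (∏ i, p i (v i)) * (a v * √(exitSum P a v)) =
        ∑ u, p 0 u * ∑ w, q w * (a (Fin.cons u w) * √(exitSum P a (Fin.cons u w))) := by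
      simp only [sum_fin_cons, Fin.prod_univ_succ, Fin.cons_zero, Fin.cons_succ, hq,
        Finset.mul_sum, mul_assoc]
    rw [eL, eR]
    refine ((hiso 0).profile_mean_le hβ (hp 0) (hp1 0) f hf0 hf1 (hP 0).nonneg).trans
      (Finset.sum_le_sum fun u _ => mul_le_mul_of_nonneg_left ?_ (hp 0 u))
    have hih := ih (fun i => P i.succ) (fun i => hP i.succ) (fun i => p i.succ)
      (fun i => hp i.succ) (fun i => hp1 i.succ) (fun i => hiso i.succ)
      (fun w => a (Fin.cons u w)) fun w => ha _
    set D : (∀ i : Fin n, K i.succ) → ℝ := fun w => ∑ z, P 0 u z * (1 - a (Fin.cons z w)) with hD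
    set E : (∀ i : Fin n, K i.succ) → ℝ :=
      exitSum (fun i => P i.succ) (fun w' => a (Fin.cons u w')) with hE
    have hE0 : ∀ w, 0 ≤ E w := exitSum_nonneg (fun i => (hP i.succ).nonneg) fun w => ha _
    have hD0 : ∀ w, 0 ≤ D w := fun w => Finset.sum_nonneg fun z _ =>
      mul_nonneg ((hP 0).nonneg _ _) <| by
        rcases ha (Fin.cons z w) with h | h <;> rw [h] <;> norm_num
    -- A drop in slice measure is at most the measure of the points of slice `u` missing from slice
    -- `v`; averaging over `v` produces `D`.
    have hM : √2 * ∑ v, P 0 u v * max (f u - f v) 0 ≤ ∑ w, q w * (a (Fin.cons u w) * √(D w)) := by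
      have h1 : ∀ v, max (f u - f v) 0 ≤
          ∑ w, q w * (a (Fin.cons u w) * (1 - a (Fin.cons v w))) := by
        intro v
        refine max_le ?_ (Finset.sum_nonneg fun w _ => mul_nonneg (hq0 w) ?_)
        · rw [hf, ← Finset.sum_sub_distrib]
          refine Finset.sum_le_sum fun w _ => ?_
          rw [← mul_sub]
          refine mul_le_mul_of_nonneg_left ?_ (hq0 w)
          rcases ha (Fin.cons u w) with h | h <;> rcases ha (Fin.cons v w) with h' | h' <;>
            simp [h, h']
        · refine mul_nonneg (ha0 _) ?_
          rcases ha (Fin.cons v w) with h | h <;> rw [h] <;> norm_num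
      calc √2 * ∑ v, P 0 u v * max (f u - f v) 0
          ≤ √2 * ∑ v, P 0 u v * ∑ w, q w * (a (Fin.cons u w) * (1 - a (Fin.cons v w))) := by
            gcongr with v _
            · exact (hP 0).nonneg _ _
            · exact h1 v
        _ = ∑ w, q w * (a (Fin.cons u w) * (√2 * D w)) := by
            simp only [hD, Finset.mul_sum]
            rw [Finset.sum_comm]
            exact Finset.sum_congr rfl fun w _ => Finset.sum_congr rfl fun v _ => by ring
        _ ≤ _ := by
            refine Finset.sum_le_sum fun w _ => mul_le_mul_of_nonneg_left ?_ (hq0 w)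
            rcases ha (Fin.cons u w) with h | h
            · simp [h]
            · rw [h, one_mul, one_mul]
              exact sqrt_two_mul_le_sqrt (hD0 w)
                ((hP 0).sum_mul_one_sub_le_half (a := fun z => a (Fin.cons z w)) (fun z => ha _) h)
    have hM0 : 0 ≤ √2 * ∑ v, P 0 u v * max (f u - f v) 0 :=
      mul_nonneg (Real.sqrt_nonneg _) (Finset.sum_nonneg fun v _ =>
        mul_nonneg ((hP 0).nonneg _ _) (le_max_right _ _))
    refine (Real.sqrt_le_sqrt (add_le_add (pow_le_pow_left₀ hM0 hM 2) (pow_le_pow_left₀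
      (mul_nonneg hβ (profile_nonneg (hf0 u) (hf1 u))) hih 2))).trans
      ((sqrt_sq_sum_add_le q _ _ hq0).trans_eq ?_)
    refine Finset.sum_congr rfl fun w _ => ?_
    rw [exitSum_cons, mul_pow, mul_pow, Real.sq_sqrt (hD0 w), Real.sq_sqrt (hE0 w), ← mul_add,
      Real.sqrt_mul (sq_nonneg _), Real.sqrt_sq (ha0 _)]

/-! ### Stationary distributions and product steps -/

theorem IsLazyIrreducibleChain.forall_of_closed {ι : Type*} [Fintype ι] [DecidableEq ι] {P : Matrix ι ι ℝ}
    (hP : IsLazyIrreducibleChain P) {Z : ι → Prop} (hZ : ∀ u v, Z v → 0 < P u v → Z u)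
    {v : ι} (hv : Z v) (u : ι) : Z u := by
  obtain ⟨t, ht⟩ := hP.irreducible u v
  induction t generalizing v with
  | zero =>
    rcases eq_or_ne u v with rfl | h
    · exact hv
    · simp [Matrix.one_apply_ne h] at ht
  | succ t ih =>
    rw [pow_succ, Matrix.mul_apply] at ht
    obtain ⟨w, -, hw⟩ := Finset.exists_lt_of_sum_lt (show
      ∑ w : ι, (0 : ℝ) < ∑ w, (P ^ t) u w * P w v by simpa using ht)
    have hwv : 0 < P w v := (hP.nonneg w v).lt_of_ne fun h => by simp [← h] at hw
    exact ih (hZ w v hv hwv) (pos_of_mul_pos_left hw hwv.le)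

/-- The zero set of a nonnegative stationary vector is closed under predecessors; with
irreducibility this yields both positivity and uniqueness. -/
theorem eq_zero_of_stationary_of_pos {ι : Type*} [Fintype ι] {P : Matrix ι ι ℝ} {ρ : ι → ℝ}
    (hP : ∀ u v, 0 ≤ P u v) (hρ : ∀ v, 0 ≤ ρ v) (hs : ∀ v, ∑ u, ρ u * P u v = ρ v)
    (u v : ι) (hv : ρ v = 0) (huv : 0 < P u v) : ρ u = 0 := by
  have h := hs v
  rw [hv, Finset.sum_eq_zero_iff_of_nonneg fun u _ => mul_nonneg (hρ u) (hP u v)] at h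
  exact (mul_eq_zero.1 (h u (Finset.mem_univ u))).resolve_right huv.ne'

theorem IsStationaryDistribution.pos {ι : Type*} [Fintype ι] [DecidableEq ι] {P : Matrix ι ι ℝ}
    {p : ι → ℝ} (hp : IsStationaryDistribution P p) (hP : IsLazyIrreducibleChain P) (v : ι) :
    0 < p v := by
  refine (hp.nonneg v).lt_of_ne fun h => ?_
  have h0 := IsLazyIrreducibleChain.forall_of_closed hP (Z := fun v => p v = 0)
    (eq_zero_of_stationary_of_pos hP.nonneg hp.nonneg hp.stationary) h.symm
  simpa [h0] using hp.sum_eq_one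

section product

variable {n : ℕ} {K : Fin n → Type*} [∀ i, DecidableEq (K i)]

theorem productChain_nonneg {P : ∀ i, Matrix (K i) (K i) ℝ} (hP : ∀ i u v, 0 ≤ P i u v)
    (x y : ∀ i, K i) : 0 ≤ productChain P x y :=
  mul_nonneg (by positivity) (Finset.sum_nonneg fun i _ => by
    split_ifs
    exacts [hP _ _ _, le_rfl])

theorem productChain_update_pos {P : ∀ i, Matrix (K i) (K i) ℝ} (hn : 0 < n)
    (hP : ∀ i u v, 0 ≤ P i u v) (y : ∀ i, K i) (i : Fin n) {u v : K i} (h : 0 < P i u v) :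
    0 < productChain P (Function.update y i u) (Function.update y i v) := by
  refine mul_pos (by positivity) (Finset.sum_pos' (fun i _ => ?_) ⟨i, Finset.mem_univ i, ?_⟩)
  · split_ifs
    exacts [hP _ _ _, le_rfl]
  · rw [if_pos fun j hj => by simp [hj]]
    simpa using h

variable [∀ i, Fintype (K i)]

theorem sum_ite_forall_ne (z : ∀ i, K i) (i : Fin n) (F : (∀ i, K i) → ℝ) :
    (∑ y, if ∀ j, j ≠ i → y j = z j then F y else 0) = ∑ u, F (Function.update z i u) := by
  rw [← Finset.sum_filter]
  refine Finset.sum_nbij' (fun y => y i) (fun u => Function.update z i u) (by simp) ?_ ?_ ?_ ?_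
  · intro u _
    simp only [Finset.mem_filter, Finset.mem_univ, true_and]
    exact fun j hj => Function.update_of_ne hj _ _
  · intro y hy
    simp only [Finset.mem_filter, Finset.mem_univ, true_and] at hy
    ext j
    rcases eq_or_ne j i with rfl | h
    · simp
    · simp [h, hy j h]
  · simp
  · intro y hy
    simp only [Finset.mem_filter, Finset.mem_univ, true_and] at hy
    congr 1
    ext j
    rcases eq_or_ne j i with rfl | h
    · simp
    · simp [h, hy j h]

/-- Stands in for irreducibility of the product: coordinates are changed from `v` to `u` one at a
time. -/
theorem forall_of_productChain_closed {P : ∀ i, Matrix (K i) (K i) ℝ} (hn : 0 < n)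
    (hP : ∀ i, IsLazyIrreducibleChain (P i)) {Z : (∀ i, K i) → Prop}
    (hZ : ∀ u v, Z v → 0 < productChain P u v → Z u) {v : ∀ i, K i} (hv : Z v) (u : ∀ i, K i) :
    Z u := by
  have step : ∀ (i : Fin n) (y : ∀ i, K i), Z y → ∀ u, Z (Function.update y i u) :=
    fun i y hy u => IsLazyIrreducibleChain.forall_of_closed (hP i) (Z := fun u => Z (Function.update y i u))
      (fun u v hv h => hZ _ _ hv (productChain_update_pos hn (fun i => (hP i).nonneg) y i h))
      (v := y i) (by simpa using hy) u
  have main : ∀ s : Finset (Fin n), Z (fun i => if i ∈ s then u i else v i) := by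
    intro s
    induction s using Finset.induction_on with
    | empty => simpa using hv
    | insert i s _ ih =>
      convert step i _ ih (u i) using 1
      ext j
      rcases eq_or_ne j i with rfl | h
      · simp
      · simp [h]
  simpa using main Finset.univ

theorem prod_stationary {P : ∀ i, Matrix (K i) (K i) ℝ} (hn : 0 < n) {p : ∀ i, K i → ℝ}
    (hp : ∀ i, IsStationaryDistribution (P i) (p i)) (y : ∀ i, K i) :
    ∑ x, (∏ i, p i (x i)) * productChain P x y = ∏ i, p i (y i) := by
  have h : ∀ i, ∑ x : ∀ i, K i, (∏ j, p j (x j)) *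
      (if ∀ j, j ≠ i → y j = x j then P i (x i) (y i) else 0) = ∏ j, p j (y j) := by
    intro i
    have e : ∀ x : ∀ i, K i, (∏ j, p j (x j)) *
        (if ∀ j, j ≠ i → y j = x j then P i (x i) (y i) else 0) =
        if ∀ j, j ≠ i → x j = y j then (∏ j, p j (x j)) * P i (x i) (y i) else 0 := by
      intro x
      simp only [eq_comm (a := y _), mul_ite, mul_zero]
    simp only [e, sum_ite_forall_ne, Function.update_self]
    have e2 : ∀ u, ∏ j, p j (Function.update y i u j) =
        p i u * ∏ j ∈ Finset.univ.erase i, p j (y j) := by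
      intro u
      rw [← Finset.mul_prod_erase _ _ (Finset.mem_univ i), Function.update_self]
      congr 1
      exact Finset.prod_congr rfl fun j hj => by
        rw [Function.update_of_ne (Finset.ne_of_mem_erase hj)]
    rw [← Finset.mul_prod_erase _ _ (Finset.mem_univ i), ← (hp i).stationary (y i),
      Finset.sum_mul]
    exact Finset.sum_congr rfl fun u _ => by rw [e2]; ring
  have hn' : (n : ℝ) ≠ 0 := by positivity
  calc _ = (1 / (n : ℝ)) * ∑ i, ∑ x : ∀ i, K i, (∏ j, p j (x j)) *
        (if ∀ j, j ≠ i → y j = x j then P i (x i) (y i) else 0) := by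
        rw [Finset.sum_comm, Finset.mul_sum]
        refine Finset.sum_congr rfl fun x _ => ?_
        rw [productChain, ← Finset.mul_sum]; ring
    _ = _ := by
        simp only [h, Finset.sum_const, Finset.card_univ, Fintype.card_fin, nsmul_eq_mul]
        field_simp

/-- Subtract from `μ` the largest multiple of the product measure that leaves it nonnegative: the
remainder is stationary with a zero, hence zero. -/
theorem stationary_productChain_eq {P : ∀ i, Matrix (K i) (K i) ℝ} (hn : 0 < n)
    (hP : ∀ i, IsLazyIrreducibleChain (P i)) {p : ∀ i, K i → ℝ}
    (hp : ∀ i, IsStationaryDistribution (P i) (p i)) {μ : (∀ i, K i) → ℝ}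
    (hμ : IsStationaryDistribution (productChain P) μ) : μ = fun v => ∏ i, p i (v i) := by
  set ν : (∀ i, K i) → ℝ := fun v => ∏ i, p i (v i) with hν
  have hν0 : ∀ v, 0 < ν v := fun v => Finset.prod_pos fun i _ => (hp i).pos (hP i) _
  have hν1 : ∑ v, ν v = 1 := sum_pi_prod_eq_one fun i => (hp i).sum_eq_one
  have hne : (Finset.univ : Finset (∀ i, K i)).Nonempty := by
    by_contra h
    simp [Finset.not_nonempty_iff_eq_empty.1 h] at hν1
  obtain ⟨x₀, -, hx₀⟩ := Finset.exists_min_image Finset.univ (fun v => μ v / ν v) hne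
  set c := μ x₀ / ν x₀ with hc
  have h0 := forall_of_productChain_closed hn hP (Z := fun v => μ v - c * ν v = 0)
    (eq_zero_of_stationary_of_pos (productChain_nonneg fun i => (hP i).nonneg)
      (fun v => sub_nonneg.2 ((le_div_iff₀ (hν0 v)).1 (hx₀ v (Finset.mem_univ v))))
      (fun v => by
        simp only [sub_mul, Finset.sum_sub_distrib, mul_assoc, ← Finset.mul_sum]
        rw [hμ.stationary, prod_stationary hn hp]))
    (v := x₀) (by rw [hc, div_mul_cancel₀ _ (hν0 x₀).ne', sub_self])
  have hc1 : c = 1 := by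
    have := Finset.sum_congr (rfl : Finset.univ = Finset.univ) fun v _ => h0 v
    rw [Finset.sum_sub_distrib, ← Finset.mul_sum, hμ.sum_eq_one, hν1] at this
    simp at this; linarith
  ext v
  have := h0 v
  rw [hc1, one_mul] at this
  linarith

theorem sum_productChain_compl (P : ∀ i, Matrix (K i) (K i) ℝ) (A : Finset (∀ i, K i))
    (v : ∀ i, K i) : ∑ w ∈ Aᶜ, productChain P v w =
      exitSum P (fun v => if v ∈ A then 1 else 0) v / n := by
  have h : ∀ i, (∑ w ∈ Aᶜ, if ∀ j, j ≠ i → w j = v j then P i (v i) (w i) else 0) =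
      ∑ u, P i (v i) u * (1 - if Function.update v i u ∈ A then 1 else 0) := by
    intro i
    have e := sum_ite_forall_ne v i fun w => P i (v i) (w i) * (1 - if w ∈ A then 1 else 0)
    simp only [Function.update_self] at e
    rw [← e, ← Finset.sum_add_sum_compl A, Finset.sum_eq_zero (s := A), zero_add]
    · exact Finset.sum_congr rfl fun w hw => by simp [Finset.mem_compl.1 hw]
    · intro w hw
      simp [hw]
  simp only [productChain]
  rw [← Finset.mul_sum, Finset.sum_comm, exitSum]
  simp only [h]
  ring

end product

/-! ### From Murali's constant to the theorem -/

theorem isoperimetricBound_of_le_muraliConst {ι : Type*} [Fintype ι] [DecidableEq ι]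
    {P : Matrix ι ι ℝ} {p : ι → ℝ} (hP : ∀ u v, 0 ≤ P u v) (hp : IsStationaryDistribution P p)
    {β : ℝ} (hβ : 0 ≤ β) (h : ENNReal.ofReal β ≤ muraliConst P p) :
    IsoperimetricBound P p β := by
  intro a ha
  set A : Finset ι := Finset.univ.filter fun v => a v = 1 with hA
  have hAc : ∀ v, v ∈ Aᶜ ↔ a v = 0 := fun v => by
    rcases ha v with h | h <;> simp [hA, h]
  have hAm : ∀ v, v ∈ A ↔ a v = 1 := fun v => by simp [hA]
  have e1 : ∑ v, p v * a v = setMeasure p A := by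
    rw [← Finset.sum_add_sum_compl A, Finset.sum_eq_zero (s := Aᶜ), add_zero, setMeasure]
    · exact Finset.sum_congr rfl fun v hv => by rw [(hAm v).1 hv, mul_one]
    · intro v hv; rw [(hAc v).1 hv, mul_zero]
  have e2 : 1 - setMeasure p A = setMeasure p Aᶜ := by
    rw [← hp.sum_eq_one, ← Finset.sum_add_sum_compl A]; simp [setMeasure]
  have e3 : ∑ u, ∑ v, p u * P u v * (a u * (1 - a v)) = ergodicFlow P p A Aᶜ := by
    rw [← Finset.sum_add_sum_compl A, Finset.sum_eq_zero (s := Aᶜ), add_zero, ergodicFlow]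
    · refine Finset.sum_congr rfl fun u hu => ?_
      rw [← Finset.sum_add_sum_compl A, Finset.sum_eq_zero (s := A), zero_add]
      · exact Finset.sum_congr rfl fun v hv => by rw [(hAm u).1 hu, (hAc v).1 hv]; ring
      · intro v hv; rw [(hAm v).1 hv]; ring
    · intro u hu
      exact Finset.sum_eq_zero fun v _ => by rw [(hAc u).1 hu]; ring
  rw [e1, e2, e3]
  have hQ : 0 ≤ ergodicFlow P p A Aᶜ := Finset.sum_nonneg fun u _ => Finset.sum_nonneg fun v _ =>
    mul_nonneg (hp.nonneg u) (hP u v)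
  -- Murali's infimum omits the empty and full sets; for these the left side is zero.
  rcases A.eq_empty_or_nonempty with h1 | h1
  · simpa [h1, setMeasure] using hQ
  rcases Aᶜ.eq_empty_or_nonempty with h2 | h2
  · simpa [h2, setMeasure] using hQ
  have h0 : 0 ≤ setMeasure p A * setMeasure p Aᶜ :=
    mul_nonneg (Finset.sum_nonneg fun v _ => hp.nonneg v) (Finset.sum_nonneg fun v _ => hp.nonneg v)
  rcases h0.eq_or_lt with h3 | h3
  · simpa [← h3] using hQ
  have h4 : ENNReal.ofReal (β ^ 2) ≤ muraliSq P p := by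
    rw [muraliConst, ← ENNReal.rpow_le_rpow_iff (z := 2) (by norm_num), ← ENNReal.rpow_mul] at h
    rw [ENNReal.ofReal_pow hβ]
    simpa using h
  have h5 : β ^ 2 ≤ ergodicFlow P p A Aᶜ ^ 2 / (setMeasure p A * setMeasure p Aᶜ) :=
    (ENNReal.ofReal_le_ofReal_iff (by positivity)).1
      (h4.trans (iInf_le_of_le A (iInf_le_of_le h1 (iInf_le _ h2))))
  rw [le_div_iff₀ h3] at h5
  refine le_of_sq_le_sq ?_ hQ
  rwa [mul_pow, Real.sq_sqrt h0]

theorem half_mul_sqrt_le_profile {a x : ℝ} (ha : 0 < a) (hax : a ≤ x) (hx : x ≤ 1 / 2) :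
    1 / 2 * √(-Real.log (x * (1 - x))) * a ≤ profile a := by
  have h1 : a * (1 - a) ≤ x * (1 - x) := by nlinarith
  have h2 : 0 < a * (1 - a) := mul_pos ha (by linarith)
  have h3 : √(-Real.log (x * (1 - x))) ≤ √(-Real.log (a * (1 - a))) :=
    Real.sqrt_le_sqrt (neg_le_neg (Real.log_le_log h2 h1))
  calc _ = a * (1 / 2) * √(-Real.log (x * (1 - x))) := by ring
    _ ≤ a * (1 - a) * √(-Real.log (a * (1 - a))) := by gcongr; linarith

theorem mainTheorem5 {n : ℕ} (hn : 0 < n) {K : Fin n → Type*}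
    [∀ i, Fintype (K i)] [∀ i, DecidableEq (K i)]
    (P : ∀ i, Matrix (K i) (K i) ℝ) (hP : ∀ i, IsLazyIrreducibleChain (P i))
    (π : ∀ i, K i → ℝ) (hπ : ∀ i, IsStationaryDistribution (P i) (π i))
    (μ : (∀ i, K i) → ℝ) (hμ : IsStationaryDistribution (productChain P) μ)
    (x : ℝ) (hx : 0 < x) (hx' : x ≤ 1 / 2) :
    (1 / 2 : ℝ≥0∞) * (⨅ i, muraliConst (P i) (π i)) *
        ENNReal.ofReal √(-Real.log (x * (1 - x)) / n) ≤
      gradTwo (productChain P) μ x := by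
  have hμ1 := stationary_productChain_eq hn hP hπ hμ
  refine le_iInf fun A => le_iInf fun hA => le_iInf fun hAc => le_iInf fun hAx => ?_
  have hμ0 : ∀ v, 0 < μ v := fun v => by
    rw [hμ1]; exact Finset.prod_pos fun i _ => (hπ i).pos (hP i) _
  have hApos : 0 < setMeasure μ A := Finset.sum_pos (fun v _ => hμ0 v) hA
  have hAcpos : 0 < setMeasure μ Aᶜ := Finset.sum_pos (fun v _ => hμ0 v) hAc
  have hbound : ∀ β : ℝ, 0 ≤ β → ENNReal.ofReal β ≤ ⨅ i, muraliConst (P i) (π i) →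
      1 / 2 * β * √(-Real.log (x * (1 - x)) / n) ≤ gradTwoSet (productChain P) μ A := by
    intro β hβ h
    have key := profile_le_sum_sqrt_exitSum P hP π (fun i => (hπ i).nonneg)
      (fun i => (hπ i).sum_eq_one) hβ (fun i => isoperimetricBound_of_le_muraliConst (hP i).nonneg
        (hπ i) hβ (h.trans (iInf_le _ i))) (fun v => if v ∈ A then 1 else 0)
      fun v => by split_ifs <;> simp
    have e1 : ∑ v, (∏ i, π i (v i)) * (if v ∈ A then (1 : ℝ) else 0) = setMeasure μ A := by
      simp [setMeasure, hμ1, Finset.sum_ite_mem]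
    have e2 : ∑ v, (∏ i, π i (v i)) * ((if v ∈ A then (1 : ℝ) else 0) *
        √(exitSum P (fun v => if v ∈ A then 1 else 0) v)) =
        √n * flowTwo (productChain P) μ A Aᶜ := by
      rw [flowTwo, Finset.mul_sum, ← Finset.sum_add_sum_compl A, Finset.sum_eq_zero (s := Aᶜ),
        add_zero]
      · refine Finset.sum_congr rfl fun v hv => ?_
        have hn' : √(n : ℝ) ≠ 0 := by positivity
        rw [if_pos hv, sum_productChain_compl, Real.sqrt_div' _ (Nat.cast_nonneg n), hμ1]
        field_simp
      · intro v hv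
        rw [if_neg (Finset.mem_compl.1 hv)]; ring
    rw [e1, e2] at key
    have hn' : 0 < √(n : ℝ) := by positivity
    have hflow : 0 ≤ flowTwo (productChain P) μ A Aᶜ :=
      Finset.sum_nonneg fun v _ => mul_nonneg (Real.sqrt_nonneg _) (hμ0 v).le
    have h1 := mul_le_mul_of_nonneg_left (half_mul_sqrt_le_profile hApos hAx hx') hβ
    rw [gradTwoSet, le_div_iff₀ (lt_min hApos hAcpos), Real.sqrt_div' _ (Nat.cast_nonneg n)]
    calc _ ≤ 1 / 2 * β * (√(-Real.log (x * (1 - x))) / √n) * setMeasure μ A := by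
          gcongr; exact min_le_left _ _
      _ = β * (1 / 2 * √(-Real.log (x * (1 - x))) * setMeasure μ A) / √n := by ring
      _ ≤ √n * flowTwo (productChain P) μ A Aᶜ / √n := by exact div_le_div_of_nonneg_right (h1.trans key) hn'.le
      _ = _ := by field_simp
  have hs : 0 < √(-Real.log (x * (1 - x)) / n) := by
    have : Real.log (x * (1 - x)) < 0 := Real.log_neg (by nlinarith) (by nlinarith)
    have : 0 < -Real.log (x * (1 - x)) := by linarith
    positivity
  -- Were the minimum infinite, as for one-point factors, `hbound` would hold for every real `β`,
  -- contradicting the finite gradient of `A`.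
  have hfin : (⨅ i, muraliConst (P i) (π i)) ≠ ⊤ := by
    intro htop
    have hg : 0 ≤ gradTwoSet (productChain P) μ A :=
      div_nonneg (Finset.sum_nonneg fun v _ => mul_nonneg (Real.sqrt_nonneg _) (hμ0 v).le)
        (lt_min hApos hAcpos).le
    have h := hbound ((gradTwoSet (productChain P) μ A + 1) /
      (1 / 2 * √(-Real.log (x * (1 - x)) / n))) (by positivity)
      (by rw [htop]; exact le_top)
    rw [mul_right_comm, mul_div_cancel₀ _ (by positivity)] at h
    linarith
  have h := hbound _ ENNReal.toReal_nonneg (ENNReal.ofReal_toReal hfin).le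
  refine le_trans (le_of_eq ?_) (ENNReal.ofReal_le_ofReal h)
  rw [ENNReal.ofReal_mul (by positivity), ENNReal.ofReal_mul (by positivity),
    ENNReal.ofReal_toReal hfin]
  congr 2
  rw [one_div, one_div, ENNReal.ofReal_inv_of_pos two_pos]
  simp
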